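/- Let $1\le i\le n$ and $m\ge 0$ be integers. Let $W=S_{n+1}$ be the Weyl group of $\mathfrak{sl}_{n+1}(\mathbb C)$, acting by $w(\epsilon_a)=\epsilon_{w(a)}$, and let $W^i$ be the set of minimal length representatives of the cosets $W/\operatorname{Stab}_W(\omega_i)$, where $\omega_i=\epsilon_1+\dots+\epsilon_i$. Put $\alpha_{k,j}=\alpha_k+\dots+\alpha_j=\epsilon_k-\epsilon_{j+1}$ for $1\le k\le j\le n$, $R^+=\{\alpha_{k,j}\}$, $R^-=-R^+$. For $w\in W^i$ put $R^-_w=w^{-1}(R^-)\cap R^+$, let $\mathfrak n^-_w\subset\mathfrak{sl}_{n+1}(\mathbb C)$ be the Lie subalgebra spanned by the root vectors $f_\alpha$ of weight $-\alpha$, $\alpha\in R^-_w$, and for $1\le k\le i$ let $$\ell_k=\max\bigl(\{i-1\}\cup\{j\mid i\le j\le n,\ \alpha_{k,j}\in R^-_w\}\bigr),\qquad \underline\ell_w=(\ell_1,\dots,\ell_i).$$ Let $\mathcal P_{\underline\ell}$ be the poset of the elements $x_{k,j}$ with $1\le k\le i$, $i\le j\le\ell_k$, ordered by $x_{k_1,j_1}\ge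 x_{k_2,j_2}$ if and only if $k_1\le k_2$ and $j_1\ge j_2$, and let $$\mathcal C_{\underline\ell}=\Bigl\{s\in(\mathbb R_{\ge0})^{\mathcal P_{\underline\ell}}\ \Bigm|\ \sum_{x\in c}s_x\le 1\text{ for all chains }c\subset\mathcal P_{\underline\ell}\Bigr\}$$ be its chain polytope; the coordinate at $x_{k,j}$ is also written $s_\alpha$ with $\alpha=\alpha_{k,j}$. Let $V(m\omega_i)$ be the simple finite-dimensional $\mathfrak{sl}_{n+1}(\mathbb C)$-module of highest weight $m\omega_i$, with highest weight vector $v_m\ne0$. The module $M=U(\mathfrak n^-_w).v_m\subset V(m\omega_i)$ is filtered by $M_s=U(\mathfrak n^-_w)_s.v_m$, where $U(\mathfrak n^-_w)_s$ is spanned by the products of at most $s$ elements of $\mathfrak n^-_w$. Its associated graded space $M^a=\bigoplus_{s\ge0}M_s/M_{s-1}$ (with $M_{-1}=0$) is a module over the symmetric algebra $S(\mathfrak n^-_w)$, where $x\in\mathfrak n^-_w$ sends the class of $y\in M_s$ to the class of $x.y$ in $M_{s+1}/M_s$. Let $w,\tau\in W^i$ with $\tau\le w$ in the Bruhat order. Then: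 1. $R^-_\tau\subseteq R^-_w$, and $m\,\mathcal C_{\underline\ell_\tau}$, embedded in the coordinate space of $m\,\mathcal C_{\underline\ell_w}$ by setting the missing coordinates to $0$, is a face of $m\,\mathcal C_{\underline\ell_w}$, namely $$m\,\mathcal C_{\underline\ell_\tau}=\bigl\{s\in m\,\mathcal C_{\underline\ell_w}\ \bigm|\ s_\alpha=0\text{ for all }\alpha\in R^-_w\setminus R^-_\tau\bigr\}.$$ 2. $(U(\mathfrak n^-_\tau).v_m)^a\subset(U(\mathfrak n^-_w).v_m)^a$; that is, $\mathfrak n^-_\tau\subseteq\mathfrak n^-_w$, and the homogeneous linear map $(U(\mathfrak n^-_\tau).v_m)^a\to(U(\mathfrak n^-_w).v_m)^a$ induced by the inclusions $U(\mathfrak n^-_\tau)_s.v_m\subset U(\mathfrak n^-_w)_s.v_m$ is injective and $S(\mathfrak n^-_\tau)$-linear. -/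

import Mathlib

open scoped Pointwise DirectSum

/-! ## Posets and chain polytopes -/

namespace ChainPoset

/-- The set of vertices `x_{k,j}`, `1 ≤ k ≤ i`, `i ≤ j ≤ ℓ_k`, attached to a sequence `ℓ`. -/
def Vert (i : ℕ) (l : ℕ → ℕ) : Type :=
  {x : ℕ × ℕ // (1 ≤ x.1 ∧ x.1 ≤ i) ∧ (i ≤ x.2 ∧ x.2 ≤ l x.1)}

/-- The partial order `x_{k₁,j₁} ≥ x_{k₂,j₂}` iff `k₁ ≤ k₂` and `j₁ ≥ j₂`. -/
instance (i : ℕ) (l : ℕ → ℕ) : PartialOrder (Vert i l) where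
  le x y := y.1.1 ≤ x.1.1 ∧ x.1.2 ≤ y.1.2
  le_refl _ := ⟨le_rfl, le_rfl⟩
  le_trans _ _ _ h h' := ⟨h'.1.trans h.1, h.2.trans h'.2⟩
  le_antisymm _ _ h h' :=
    Subtype.ext (Prod.ext (le_antisymm h'.1 h.1) (le_antisymm h.2 h'.2))

/-- The chain polytope of the poset: nonnegative points whose sum over every chain is `≤ 1`. -/
def chainPolytope (i : ℕ) (l : ℕ → ℕ) : Set (Vert i l → ℝ) :=
  {s | (∀ x, 0 ≤ s x) ∧
    ∀ c : Finset (Vert i l), IsChain (· ≤ ·) (c : Set (Vert i l)) → ∑ x ∈ c, s x ≤ 1}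

open Classical in
/-- The inclusion `ℝ^{P_ℓ} → ℝ^{P_ℓ'}` of coordinate spaces: extension by `0` of the coordinates
at the vertices that do not belong to `P_ℓ`. -/
noncomputable def extendZero (i : ℕ) (l l' : ℕ → ℕ) (s : Vert i l → ℝ) : Vert i l' → ℝ :=
  fun x => if h : (1 ≤ x.1.1 ∧ x.1.1 ≤ i) ∧ (i ≤ x.1.2 ∧ x.1.2 ≤ l x.1.1) then s ⟨x.1, h⟩ else 0

end ChainPoset

/-! ## Type `A_n` roots and the Weyl group `S_{n+1}`

Indices are `1, …, n+1` as usual; the index `a` corresponds to the element `a - 1` of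
`Fin (n + 1)`. -/

namespace TypeA

/-- The coordinate vector `ε_a`, `1 ≤ a ≤ n+1`. -/
def eps (n a : ℕ) : Fin (n + 1) → ℤ := fun b => if b.val + 1 = a then 1 else 0

/-- The simple root `α_p = ε_p - ε_{p+1}`. -/
def simpleRoot (n p : ℕ) : Fin (n + 1) → ℤ := eps n p - eps n (p + 1)

/-- `α_{k,j} = α_k + ⋯ + α_j`. -/
def root (n k j : ℕ) : Fin (n + 1) → ℤ := ∑ p ∈ Finset.Icc k j, simpleRoot n p

/-- `ω_i = ε_1 + ⋯ + ε_i`. -/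
def fundWeight (n i : ℕ) : Fin (n + 1) → ℤ := ∑ a ∈ Finset.Icc 1 i, eps n a

/-- The positive roots `R⁺`. -/
def posRoots (n : ℕ) : Set (Fin (n + 1) → ℤ) :=
  {α | ∃ k j, 1 ≤ k ∧ k ≤ j ∧ j ≤ n ∧ α = root n k j}

/-- The negative roots `R⁻ = -R⁺`. -/
def negRoots (n : ℕ) : Set (Fin (n + 1) → ℤ) := {α | -α ∈ posRoots n}

/-- The linear action of the Weyl group `S_{n+1}`, given by `w(ε_a) = ε_{w(a)}`. -/
def act {n : ℕ} (w : Equiv.Perm (Fin (n + 1))) (x : Fin (n + 1) → ℤ) : Fin (n + 1) → ℤ :=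
  fun b => x (w.symm b)

/-- `R⁻_w = w⁻¹(R⁻) ∩ R⁺`. -/
def invRoots {n : ℕ} (w : Equiv.Perm (Fin (n + 1))) : Set (Fin (n + 1) → ℤ) :=
  {α | act w α ∈ negRoots n} ∩ posRoots n

/-- The simple reflections `s_p`, i.e. the transpositions of neighbours. -/
def IsSimpleRefl {n : ℕ} (s : Equiv.Perm (Fin (n + 1))) : Prop :=
  ∃ p : Fin n, s = Equiv.swap p.castSucc p.succ

/-- The length of `w`: the least length of a word in the simple reflections with product `w`. -/
noncomputable def length {n : ℕ} (w : Equiv.Perm (Fin (n + 1))) : ℕ :=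
  sInf {r | ∃ L : List (Equiv.Perm (Fin (n + 1))),
    L.length = r ∧ (∀ s ∈ L, IsSimpleRefl s) ∧ L.prod = w}

/-- The Bruhat order: generated by `u < u t` for `t` a reflection with `length u < length (u t)`. -/
def BruhatLE {n : ℕ} : Equiv.Perm (Fin (n + 1)) → Equiv.Perm (Fin (n + 1)) → Prop :=
  Relation.ReflTransGen fun u v =>
    (∃ t : Equiv.Perm (Fin (n + 1)), t.IsSwap ∧ v = u * t) ∧ length u < length v

/-- `w` is the representative of minimal length of its coset `w Stab(ω_i)`. -/
def IsMinRep {n : ℕ} (i : ℕ) (w : Equiv.Perm (Fin (n + 1))) : Prop :=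
  ∀ u : Equiv.Perm (Fin (n + 1)), act u (fundWeight n i) = fundWeight n i →
    length w ≤ length (w * u)

/-- The sequence `ℓ_w`: `ℓ_k = max ({i-1} ∪ {j | i ≤ j ≤ n, α_{k,j} ∈ R⁻_w})`. -/
noncomputable def ellSeq {n : ℕ} (i : ℕ) (w : Equiv.Perm (Fin (n + 1))) : ℕ → ℕ :=
  fun k => sSup ({i - 1} ∪ {j | i ≤ j ∧ j ≤ n ∧ root n k j ∈ invRoots w})

/-- The Lie algebra `sl_{n+1}(ℂ)`. -/
abbrev sl (n : ℕ) :=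
  LieAlgebra.SpecialLinear.sl (Fin (n + 1)) ℂ

/-- The matrix unit `E_{p,q}`, `1 ≤ p, q ≤ n+1`. -/
def matUnit (n p q : ℕ) : Matrix (Fin (n + 1)) (Fin (n + 1)) ℂ :=
  Matrix.of fun a b => if a.val + 1 = p ∧ b.val + 1 = q then 1 else 0

/-- `n⁻_w`: the Lie subalgebra generated by the root vectors `f_α`, `α ∈ R⁻_w`, where
`f_{α_{k,j}} = E_{j+1,k}`. -/
noncomputable def nMinus {n : ℕ} (w : Equiv.Perm (Fin (n + 1))) : LieSubalgebra ℂ (sl n) :=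
  LieSubalgebra.lieSpan ℂ (sl n)
    {x | ∃ k j, 1 ≤ k ∧ k ≤ j ∧ j ≤ n ∧ root n k j ∈ invRoots w ∧ x.val = matUnit n (j + 1) k}

/-- `v` is a highest weight vector of weight `m ω_i`: nonzero, killed by all strictly upper
triangular matrices, and a diagonal matrix `h` acts on it by `m (h_{11} + ⋯ + h_{ii})`. -/
structure IsHighestWeightVector (n i m : ℕ) {V : Type*} [AddCommGroup V] [Module ℂ V]
    [LieRingModule (sl n) V] [LieModule ℂ (sl n) V] (v : V) : Prop where
  ne_zero : v ≠ 0
  upper : ∀ x : sl n, (∀ a b, b ≤ a → x.val a b = 0) → ⁅x, v⁆ = 0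
  weight : ∀ h : sl n, h.val.IsDiag →
    ⁅h, v⁆ = ((m : ℂ) * ∑ a : Fin (n + 1), if a.val < i then h.val a a else 0) • v

end TypeA

/-! ## The PBW filtration and the associated graded module of a cyclic module -/

namespace PBW

section

variable {L : Type*} [LieRing L] [LieAlgebra ℂ L]

/-- `U(u)_s`: the span of all products of at most `s` elements of `u` in `U(u)`. -/
noncomputable def envFil (u : LieSubalgebra ℂ L) (s : ℕ) :
    Submodule ℂ (UniversalEnvelopingAlgebra ℂ u) :=
  Submodule.span ℂ {a | ∃ l : List u, l.length ≤ s ∧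
    a = (l.map (UniversalEnvelopingAlgebra.ι ℂ)).prod}

variable {V : Type*} [AddCommGroup V] [Module ℂ V] [LieRingModule L V] [LieModule ℂ L V]

/-- The map `U(u) → V`, `a ↦ a.v`. -/
noncomputable def orbitMap (u : LieSubalgebra ℂ L) (v : V) :
    UniversalEnvelopingAlgebra ℂ u →ₗ[ℂ] V :=
  LinearMap.applyₗ v ∘ₗ
    (UniversalEnvelopingAlgebra.lift ℂ (LieModule.toEnd ℂ u V)).toLinearMap

/-- The filtration `M_s = U(u)_s.v` of `M = U(u).v`. -/
noncomputable def fil (u : LieSubalgebra ℂ L) (v : V) (s : ℕ) : Submodule ℂ V :=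
  (envFil u s).map (orbitMap u v)

/-- `M_{s-1}`, where `M_{-1} = 0`. -/
noncomputable def filPred (u : LieSubalgebra ℂ L) (v : V) : ℕ → Submodule ℂ V
  | 0 => ⊥
  | s + 1 => fil u v s

/-- The graded piece `M_s / M_{s-1}`. -/
abbrev GrPiece (u : LieSubalgebra ℂ L) (v : V) (s : ℕ) : Type _ :=
  fil u v s ⧸ (filPred u v s).comap (fil u v s).subtype

/-- The PBW graded module `M^a = ⨁ M_s / M_{s-1}` of `M = U(u).v`. -/
abbrev Gr (u : LieSubalgebra ℂ L) (v : V) : Type _ := ⨁ s : ℕ, GrPiece u v s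

theorem fil_eq_span (u : LieSubalgebra ℂ L) (v : V) (s : ℕ) :
    fil u v s = Submodule.span ℂ {y | ∃ l : List u, l.length ≤ s ∧
      y = (l.map (LieModule.toEnd ℂ u V)).prod v} := by
  rw [fil, envFil, Submodule.map_span]
  congr 1
  have key : ∀ l : List u, orbitMap u v ((l.map (UniversalEnvelopingAlgebra.ι ℂ)).prod) =
      (l.map (LieModule.toEnd ℂ u V)).prod v := by
    intro l
    simp only [orbitMap, LinearMap.comp_apply, AlgHom.toLinearMap_apply, map_list_prod,
      List.map_map, LinearMap.applyₗ_apply_apply, UniversalEnvelopingAlgebra.ι_comp_lift]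
  ext y
  constructor
  · rintro ⟨a, ⟨l, hl, rfl⟩, rfl⟩
    exact ⟨l, hl, key l⟩
  · rintro ⟨l, hl, rfl⟩
    exact ⟨_, ⟨l, hl, rfl⟩, key l⟩

theorem fil_mono_right (u : LieSubalgebra ℂ L) (v : V) (s : ℕ) : fil u v s ≤ fil u v (s + 1) := by
  rw [fil_eq_span, fil_eq_span]
  exact Submodule.span_mono fun y ⟨l, hl, h⟩ => ⟨l, hl.trans (Nat.le_succ s), h⟩

theorem fil_mono_left {u₁ u₂ : LieSubalgebra ℂ L} (h : u₁ ≤ u₂) (v : V) (s : ℕ) :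
    fil u₁ v s ≤ fil u₂ v s := by
  rw [fil_eq_span, fil_eq_span]
  refine Submodule.span_mono ?_
  rintro y ⟨l, hl, rfl⟩
  refine ⟨l.map (LieSubalgebra.inclusion h), by simpa using hl, ?_⟩
  rw [List.map_map]
  rfl

theorem filPred_mono_left {u₁ u₂ : LieSubalgebra ℂ L} (h : u₁ ≤ u₂) (v : V) (s : ℕ) :
    filPred u₁ v s ≤ filPred u₂ v s := by
  cases s with
  | zero => exact le_rfl
  | succ s => exact fil_mono_left h v s

theorem lie_mem_fil (u : LieSubalgebra ℂ L) (v : V) (s : ℕ) (x : u) {y : V}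
    (hy : y ∈ fil u v s) : ⁅x, y⁆ ∈ fil u v (s + 1) := by
  rw [fil_eq_span] at hy
  rw [fil_eq_span]
  induction hy using Submodule.span_induction with
  | mem y hy =>
    obtain ⟨l, hl, rfl⟩ := hy
    refine Submodule.subset_span ⟨x :: l, by simpa using hl, ?_⟩
    rw [List.map_cons, List.prod_cons]
    rfl
  | zero => simp
  | add a b _ _ ha hb => rw [lie_add]; exact Submodule.add_mem _ ha hb
  | smul c a _ ha => rw [lie_smul]; exact Submodule.smul_mem _ _ ha

theorem lie_mem_filPred (u : LieSubalgebra ℂ L) (v : V) (s : ℕ) (x : u) {y : V}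
    (hy : y ∈ filPred u v s) : ⁅x, y⁆ ∈ fil u v s := by
  cases s with
  | zero =>
    rw [filPred, Submodule.mem_bot] at hy
    rw [hy, lie_zero]
    exact Submodule.zero_mem _
  | succ s => exact lie_mem_fil u v s x hy

/-- The operator `M_s → M_{s+1}` given by `x ∈ u`. -/
noncomputable def filAct (u : LieSubalgebra ℂ L) (v : V) (x : u) (s : ℕ) :
    fil u v s →ₗ[ℂ] fil u v (s + 1) :=
  ((LieModule.toEnd ℂ u V x) ∘ₗ (fil u v s).subtype).codRestrict _
    fun y => lie_mem_fil u v s x y.2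

/-- The induced operator `M_s / M_{s-1} → M_{s+1} / M_s`, `[y] ↦ [x.y]`. -/
noncomputable def pieceAct (u : LieSubalgebra ℂ L) (v : V) (x : u) (s : ℕ) :
    GrPiece u v s →ₗ[ℂ] GrPiece u v (s + 1) :=
  Submodule.mapQ _ _ (filAct u v x s) fun _ hy => lie_mem_filPred u v s x hy

/-- The operator on `M^a` given by `x ∈ u`. -/
noncomputable def grActFun (u : LieSubalgebra ℂ L) (v : V) (x : u) : Module.End ℂ (Gr u v) :=
  DirectSum.toModule ℂ ℕ (Gr u v) fun s =>
    DirectSum.lof ℂ ℕ (GrPiece u v) (s + 1) ∘ₗ pieceAct u v x s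

theorem grActFun_lof (u : LieSubalgebra ℂ L) (v : V) (x : u) (s : ℕ) (y : fil u v s) :
    grActFun u v x (DirectSum.lof ℂ ℕ (GrPiece u v) s (Submodule.Quotient.mk y)) =
      DirectSum.lof ℂ ℕ (GrPiece u v) (s + 1) (Submodule.Quotient.mk (filAct u v x s y)) := by
  rw [grActFun, DirectSum.toModule_lof]
  rfl

/-- Two endomorphisms of `M^a` agree if they agree on the classes of all `y ∈ M_s`. -/
theorem gr_ext {u : LieSubalgebra ℂ L} {v : V} {N : Type*} [AddCommGroup N] [Module ℂ N]
    {F G : Gr u v →ₗ[ℂ] N}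
    (h : ∀ s (y : fil u v s), F (DirectSum.lof ℂ ℕ (GrPiece u v) s (Submodule.Quotient.mk y)) =
      G (DirectSum.lof ℂ ℕ (GrPiece u v) s (Submodule.Quotient.mk y))) : F = G := by
  refine DirectSum.linearMap_ext ℂ fun s => LinearMap.ext fun z => ?_
  obtain ⟨y, rfl⟩ := Submodule.Quotient.mk_surjective _ z
  exact h s y

/-- `u → End(M^a)`. -/
noncomputable def grAct (u : LieSubalgebra ℂ L) (v : V) : u →ₗ[ℂ] Module.End ℂ (Gr u v) where
  toFun := grActFun u v
  map_add' x x' := gr_ext (u := u) (v := v) (N := Gr u v) fun s y => by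
    rw [LinearMap.add_apply, grActFun_lof, grActFun_lof, grActFun_lof, ← map_add,
      ← Submodule.Quotient.mk_add]
    congr 2
    exact Subtype.ext (add_lie x x' (y : V))
  map_smul' c x := gr_ext (u := u) (v := v) (N := Gr u v) fun s y => by
    rw [LinearMap.smul_apply, grActFun_lof, grActFun_lof, RingHom.id_apply, ← map_smul,
      ← Submodule.Quotient.mk_smul]
    congr 2
    exact Subtype.ext (smul_lie c x (y : V))

theorem grAct_comm (u : LieSubalgebra ℂ L) (v : V) (x x' : u) :
    grAct u v x * grAct u v x' = grAct u v x' * grAct u v x := by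
  refine gr_ext (u := u) (v := v) (N := Gr u v) fun s y => ?_
  rw [Module.End.mul_apply, Module.End.mul_apply]
  simp only [grAct, LinearMap.coe_mk, AddHom.coe_mk]
  rw [grActFun_lof, grActFun_lof, grActFun_lof, grActFun_lof]
  congr 1
  rw [Submodule.Quotient.eq]
  change ⁅x, ⁅x', (y : V)⁆⁆ - ⁅x', ⁅x, (y : V)⁆⁆ ∈ fil u v (s + 1)
  rw [← lie_lie]
  exact lie_mem_fil u v s _ y.2

/-- The action of the symmetric algebra `S(u)` on `M^a`. -/
noncomputable def symAct (u : LieSubalgebra ℂ L) (v : V) :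
    SymmetricAlgebra ℂ u →ₐ[ℂ] Module.End ℂ (Gr u v) :=
  RingCon.liftₐ (TensorAlgebra.symRingCon ℂ u) (TensorAlgebra.lift ℂ (grAct u v)) <| by
    refine RingCon.ringConGen_le.2 fun a b h => ?_
    induction h with
    | mul_comm x y =>
      rw [RingCon.ker_apply]
      simpa using grAct_comm u v x y

/-- The map `M₁^a → M₂^a` for `u₁ ⊆ u₂`, `M_j = U(u_j).v`, that is induced by the inclusions
`U(u₁)_s.v ⊆ U(u₂)_s.v`; it is homogeneous of degree `0`. -/
noncomputable def grMap {u₁ u₂ : LieSubalgebra ℂ L} (h : u₁ ≤ u₂) (v : V) :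
    Gr u₁ v →ₗ[ℂ] Gr u₂ v :=
  DirectSum.toModule ℂ ℕ (Gr u₂ v) fun s =>
    DirectSum.lof ℂ ℕ (GrPiece u₂ v) s ∘ₗ
      Submodule.mapQ _ _ (Submodule.inclusion (fil_mono_left h v s))
        fun _ hy => filPred_mono_left h v s hy

/-- The inclusion-induced map `S(u₁) → S(u₂)` for `u₁ ⊆ u₂`. -/
noncomputable def symMap {u₁ u₂ : LieSubalgebra ℂ L} (h : u₁ ≤ u₂) :
    SymmetricAlgebra ℂ u₁ →ₐ[ℂ] SymmetricAlgebra ℂ u₂ :=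
  SymmetricAlgebra.lift
    (SymmetricAlgebra.ι ℂ u₂ ∘ₗ (LieSubalgebra.inclusion h : u₁ →ₗ[ℂ] u₂))

end

end PBW

/-!
Both parts rest on the inclusion `R⁻_τ ⊆ R⁻_w`. Minimal representatives are increasing on the blocks
`{1, …, i}` and `{i + 1, …, n + 1}` (`TypeA.IsMinRep.lt`), and a step of the Bruhat order can only
raise the values in the first block and lower those in the second, as sets. Hence `τ ≤ w` forces
`τ(a) ≤ w(a)` on the first block and `w(b) ≤ τ(b)` on the second, so every inversion of `τ` is one
of `w` (`TypeA.BruhatLE.invRoots_subset`). The comparison of lengths with inversions that this needs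
is the strong exchange property (`TypeA.exists_shorter_word`).

The inclusion gives `ℓ_τ ≤ ℓ_w`, and the vertices of `P_{ℓ_w}` outside `P_{ℓ_τ}` are the roots in
`R⁻_w \ R⁻_τ`. Restricting a point to `P_{ℓ_τ}`, or extending it by zero, preserves the chain
inequalities, and the vanishing of a set of nonnegative coordinates cuts out an exposed face.

For the graded modules, all the roots of `R⁻_w` contain `α_i`, so the coweight `ω_i^∨` acts on
`n⁻_w` by a scalar `d ≠ 0`, while `v_m` is an eigenvector of it. A product of `r` elements of `n⁻_w`
therefore shifts the eigenvalue of `v_m` by `r d`: the PBW filtrations are induced by the eigenspace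
decomposition, whence `M^τ_s ∩ M^w_{s-1} = M^τ_{s-1}` (`PBW.fil_inf_filPred_le`), which is the
injectivity of the map of associated graded modules.
-/

/-! ### PBW filtrations in the presence of a grading element -/

namespace PBW

section

variable {L : Type*} [LieRing L] [LieAlgebra ℂ L]
variable {V : Type*} [AddCommGroup V] [Module ℂ V] [LieRingModule L V] [LieModule ℂ L V]

/-- A product of `r` eigenvectors of `ad h` with eigenvalue `d` shifts the eigenvalue by `r d`. -/
theorem toEnd_list_prod_mem_eigenspace {u : LieSubalgebra ℂ L} {h : L} {d c : ℂ} {v : V}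
    (hu : ∀ x ∈ u, ⁅h, x⁆ = d • x) (hv : ⁅h, v⁆ = c • v) (l : List u) :
    (l.map (LieModule.toEnd ℂ u V)).prod v ∈
      (LieModule.toEnd ℂ L V h).eigenspace (c + l.length * d) := by
  induction l with
  | nil => simpa [Module.End.mem_eigenspace_iff] using hv
  | cons x l ih =>
    rw [Module.End.mem_eigenspace_iff] at ih ⊢
    set y := (l.map (LieModule.toEnd ℂ u V)).prod v
    have e : ((x :: l).map (LieModule.toEnd ℂ u V)).prod v = ⁅(x : L), y⁆ := by
      rw [List.map_cons, List.prod_cons]; rfl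
    rw [e]
    change ⁅h, y⁆ = _ at ih
    change ⁅h, ⁅(x : L), y⁆⁆ = _
    rw [leibniz_lie, hu x x.2, ih, smul_lie, lie_smul, ← add_smul, List.length_cons]
    congr 1
    push_cast
    ring

/-- If some `h` acts on `u₂` by a nonzero scalar and has `v` as an eigenvector, then the PBW
filtrations are graded by the eigenvalues of `h`, so the filtration of `U(u₁).v` is induced by that
of `U(u₂).v`. -/
theorem fil_inf_filPred_le {u₁ u₂ : LieSubalgebra ℂ L} (hle : u₁ ≤ u₂) {h : L} {d c : ℂ} {v : V}
    (hd : d ≠ 0) (hu : ∀ x ∈ u₂, ⁅h, x⁆ = d • x) (hv : ⁅h, v⁆ = c • v) (s : ℕ) :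
    fil u₁ v s ⊓ filPred u₂ v s ≤ filPred u₁ v s := by
  cases s with
  | zero => exact inf_le_right
  | succ s =>
    set E := (LieModule.toEnd ℂ L V h).eigenspace
    have top : fil u₁ v (s + 1) ≤ fil u₁ v s ⊔ E (c + (s + 1 : ℕ) * d) := by
      rw [fil_eq_span u₁ v (s + 1), Submodule.span_le]
      rintro y ⟨l, hl, rfl⟩
      rcases hl.lt_or_eq with hl | hl
      · refine Submodule.mem_sup_left ?_
        rw [fil_eq_span]
        exact Submodule.subset_span ⟨l, Nat.lt_succ_iff.1 hl, rfl⟩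
      · rw [← hl]
        exact Submodule.mem_sup_right
          (toEnd_list_prod_mem_eigenspace (fun x hx => hu x (hle hx)) hv l)
    have low : fil u₂ v s ≤ ⨆ ν ≠ c + (s + 1 : ℕ) * d, E ν := by
      rw [fil_eq_span, Submodule.span_le]
      rintro y ⟨l, hl, rfl⟩
      have hne : c + (l.length : ℂ) * d ≠ c + (s + 1 : ℕ) * d := by
        intro e
        have := mul_right_cancel₀ hd (add_left_cancel e)
        have : l.length = s + 1 := by exact_mod_cast this
        omega
      exact Submodule.mem_iSup_of_mem _ (Submodule.mem_iSup_of_mem hne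
        (toEnd_list_prod_mem_eigenspace hu hv l))
    rintro y ⟨hy₁, hy₂⟩
    obtain ⟨a, ha, b, hb, rfl⟩ := Submodule.mem_sup.1 (top hy₁)
    have hb₂ : b ∈ fil u₂ v s :=
      (Submodule.add_mem_iff_right _ (fil_mono_left hle v s ha)).1 hy₂
    have hb0 : b = 0 := Submodule.disjoint_def.1
      (Module.End.eigenspaces_iSupIndep (LieModule.toEnd ℂ L V h) (c + (s + 1 : ℕ) * d))
      b hb (low hb₂)
    rw [hb0, add_zero]
    exact ha

theorem grMap_lof {u₁ u₂ : LieSubalgebra ℂ L} (h : u₁ ≤ u₂) (v : V) (s : ℕ) (y : fil u₁ v s) :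
    grMap h v (DirectSum.lof ℂ ℕ (GrPiece u₁ v) s (Submodule.Quotient.mk y)) =
      DirectSum.lof ℂ ℕ (GrPiece u₂ v) s
        (Submodule.Quotient.mk (Submodule.inclusion (fil_mono_left h v s) y)) := by
  rw [grMap, DirectSum.toModule_lof]
  rfl

theorem grMap_injective {u₁ u₂ : LieSubalgebra ℂ L} (h : u₁ ≤ u₂) (v : V)
    (hfil : ∀ s, fil u₁ v s ⊓ filPred u₂ v s ≤ filPred u₁ v s) :
    Function.Injective (grMap h v) := by
  have e : grMap h v = DirectSum.lmap fun s =>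
      Submodule.mapQ ((filPred u₁ v s).comap (fil u₁ v s).subtype)
        ((filPred u₂ v s).comap (fil u₂ v s).subtype)
        (Submodule.inclusion (fil_mono_left h v s))
        fun _ hy => filPred_mono_left h v s hy := by
    refine gr_ext (u := u₁) (v := v) (N := Gr u₂ v) fun s y => ?_
    rw [grMap_lof, DirectSum.lmap_lof]
    rfl
  rw [e, DirectSum.lmap_injective]
  intro s
  rw [← LinearMap.ker_eq_bot, Submodule.ker_mapQ, ← le_bot_iff,
    Submodule.map_le_iff_le_comap, Submodule.comap_bot, Submodule.ker_mkQ]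
  exact fun y hy => hfil s ⟨y.2, hy⟩

theorem grMap_symAct {u₁ u₂ : LieSubalgebra ℂ L} (h : u₁ ≤ u₂) (v : V)
    (p : SymmetricAlgebra ℂ u₁) (y : Gr u₁ v) :
    grMap h v (symAct u₁ v p y) = symAct u₂ v (symMap h p) (grMap h v y) := by
  have hι : ∀ (u : LieSubalgebra ℂ L) (x : u),
      symAct u v (SymmetricAlgebra.ι ℂ u x) = grAct u v x := fun u x =>
    TensorAlgebra.lift_ι_apply (grAct u v) x
  induction p using SymmetricAlgebra.induction generalizing y with
  | algebraMap r => simp only [AlgHom.commutes, Module.algebraMap_end_apply, map_smul]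
  | ι x =>
    rw [symMap, SymmetricAlgebra.lift_ι_apply, LinearMap.comp_apply, hι, hι]
    refine LinearMap.congr_fun (f := grMap h v ∘ₗ grAct u₁ v x)
      (g := grAct u₂ v (LieSubalgebra.inclusion h x) ∘ₗ grMap h v)
      (gr_ext (u := u₁) (v := v) (N := Gr u₂ v) fun s y => ?_) y
    rw [LinearMap.comp_apply, LinearMap.comp_apply, grMap_lof]
    change grMap h v (grActFun u₁ v x _) = grActFun u₂ v (LieSubalgebra.inclusion h x) _
    rw [grActFun_lof, grActFun_lof, grMap_lof]
    rfl
  | mul a b ha hb =>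
    rw [map_mul, map_mul, map_mul, Module.End.mul_apply, Module.End.mul_apply, ha, hb]
  | add a b ha hb =>
    rw [map_add, map_add, map_add, LinearMap.add_apply, LinearMap.add_apply, map_add, ha, hb]

end

end PBW

namespace TypeA

open Equiv

/-! ### Roots and inversions in coordinates -/

theorem root_eq_sub (n : ℕ) {k j : ℕ} (h : k ≤ j) : root n k j = eps n k - eps n (j + 1) := by
  induction j, h using Nat.le_induction with
  | base => simp [root, simpleRoot]
  | succ j hj ih =>
    rw [root, Finset.sum_Icc_succ_top (hj.trans (Nat.le_succ j)), ← root, ih, simpleRoot]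
    abel

/-- The positive root `ε_a - ε_b`, in terms of the indices `a, b : Fin (n + 1)`. -/
theorem root_eq_single {n : ℕ} {a b : Fin (n + 1)} (h : a < b) :
    root n (a + 1) b = Pi.single a 1 - Pi.single b 1 := by
  rw [root_eq_sub n (by omega)]
  ext c
  simp [eps, Pi.single_apply, Fin.ext_iff]

theorem mem_posRoots_iff {n : ℕ} {α : Fin (n + 1) → ℤ} :
    α ∈ posRoots n ↔ ∃ a b : Fin (n + 1), a < b ∧ α = Pi.single a 1 - Pi.single b 1 := by
  constructor
  · rintro ⟨k, j, hk, hkj, hj, rfl⟩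
    have hab : (⟨k - 1, by omega⟩ : Fin (n + 1)) < ⟨j, by omega⟩ := by
      rw [Fin.mk_lt_mk]; omega
    refine ⟨_, _, hab, ?_⟩
    rw [← root_eq_single hab]
    congr 1
    exact (Nat.sub_add_cancel hk).symm
  · rintro ⟨a, b, h, rfl⟩
    exact ⟨a + 1, b, by omega, by omega, by omega, (root_eq_single h).symm⟩

theorem act_single_sub_single {n : ℕ} (w : Perm (Fin (n + 1))) (a b : Fin (n + 1)) :
    act w (Pi.single a 1 - Pi.single b 1) = Pi.single (w a) 1 - Pi.single (w b) 1 := by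
  ext c
  simp [act, Pi.single_apply, Equiv.symm_apply_eq]

theorem single_sub_single_mem_invRoots_iff {n : ℕ} {w : Perm (Fin (n + 1))} {a b : Fin (n + 1)}
    (h : a < b) : (Pi.single a 1 - Pi.single b 1 : Fin (n + 1) → ℤ) ∈ invRoots w ↔ w b < w a := by
  refine ⟨fun H => ?_, fun H => ⟨?_, mem_posRoots_iff.2 ⟨a, b, h, rfl⟩⟩⟩
  · have H1 := H.1
    rw [Set.mem_ofPred_eq, act_single_sub_single, negRoots, Set.mem_ofPred_eq, neg_sub,
      mem_posRoots_iff] at H1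
    obtain ⟨c, d, hcd, e⟩ := H1
    have hne : w a ≠ w b := w.injective.ne h.ne
    have e1 := congrFun e (w b)
    have e2 := congrFun e (w a)
    simp only [Pi.sub_apply, Pi.single_apply] at e1 e2
    grind
  · rw [Set.mem_ofPred_eq, act_single_sub_single, negRoots, Set.mem_ofPred_eq, neg_sub]
    exact mem_posRoots_iff.2 ⟨_, _, H, rfl⟩

theorem root_mem_invRoots_iff {n : ℕ} {w : Perm (Fin (n + 1))} {a b : Fin (n + 1)}
    (h : a < b) : root n (a + 1) b ∈ invRoots w ↔ w b < w a := by
  rw [root_eq_single h, single_sub_single_mem_invRoots_iff h]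

/-! ### Length and reflections -/

theorem exists_word {n : ℕ} (w : Perm (Fin (n + 1))) :
    ∃ l : List (Perm (Fin (n + 1))), l.length = length w ∧ (∀ s ∈ l, IsSimpleRefl s) ∧
      l.prod = w := by
  refine Nat.sInf_mem (s := {r | ∃ l : List (Perm (Fin (n + 1))),
    l.length = r ∧ (∀ s ∈ l, IsSimpleRefl s) ∧ l.prod = w}) ?_
  have hw : w ∈ Submonoid.closure (Set.range fun p : Fin n => swap p.castSucc p.succ) := by
    rw [Perm.mclosure_swap_castSucc_succ]; trivial
  obtain ⟨l, hl, hp⟩ := Submonoid.exists_list_of_mem_closure hw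
  refine ⟨_, l, rfl, fun s hs => ?_, hp⟩
  obtain ⟨p, rfl⟩ := hl s hs
  exact ⟨p, rfl⟩

theorem length_prod_le {n : ℕ} {l : List (Perm (Fin (n + 1)))} (hl : ∀ s ∈ l, IsSimpleRefl s) :
    length l.prod ≤ l.length :=
  Nat.sInf_le ⟨l, rfl, hl, rfl⟩

/-- The strong exchange property: if `a < b` is an inversion of the product of a word, then the
product times the transposition of `a` and `b` is the product of a shorter word. -/
theorem exists_shorter_word {n : ℕ} (l : List (Perm (Fin (n + 1))))
    (hl : ∀ s ∈ l, IsSimpleRefl s) {a b : Fin (n + 1)} (hab : a < b) (hinv : l.prod b < l.prod a) :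
    ∃ l' : List (Perm (Fin (n + 1))), (∀ s ∈ l', IsSimpleRefl s) ∧ l'.length < l.length ∧
      l'.prod = l.prod * swap a b := by
  induction l using List.reverseRecOn generalizing a b with
  | nil => exact absurd hinv (by simpa using hab.le)
  | append_singleton l s ih =>
    have hl' : ∀ t ∈ l, IsSimpleRefl t := fun t ht => hl t (List.mem_append_left _ ht)
    obtain ⟨p, rfl⟩ := hl s (by simp)
    rw [List.prod_append, List.prod_singleton] at hinv ⊢
    by_cases hp : a = p.castSucc ∧ b = p.succ
    · refine ⟨l, hl', by simp, ?_⟩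
      rw [hp.1, hp.2, mul_assoc, swap_mul_self, mul_one]
    · -- a simple reflection preserves the order of every other pair of indices
      have hlt : swap p.castSucc p.succ a < swap p.castSucc p.succ b := by
        have h1 := Fin.val_castSucc p
        have h2 := Fin.val_succ p
        simp only [swap_apply_def, Fin.ext_iff, Fin.lt_def] at hab hp ⊢
        split_ifs <;> omega
      obtain ⟨l', h1, h2, h3⟩ := ih hl' hlt hinv
      refine ⟨l' ++ [swap p.castSucc p.succ], ?_, by simpa using h2, ?_⟩
      · intro t ht
        rcases List.mem_append.1 ht with ht | ht
        · exact h1 t ht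
        · exact ⟨p, List.mem_singleton.1 ht⟩
      · rw [List.prod_append, List.prod_singleton, h3, mul_assoc, mul_assoc,
          ← mul_swap_eq_swap_mul]

theorem length_mul_swap_lt {n : ℕ} {u : Perm (Fin (n + 1))} {a b : Fin (n + 1)} (hab : a < b)
    (hinv : u b < u a) : length (u * swap a b) < length u := by
  obtain ⟨l, hlen, hl, rfl⟩ := exists_word u
  obtain ⟨l', hl', hlt, hp⟩ := exists_shorter_word l hl hab hinv
  rw [← hp, ← hlen]
  exact (length_prod_le hl').trans_lt hlt

/-! ### Minimal representatives and the Bruhat order -/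

theorem fundWeight_apply {n i : ℕ} (b : Fin (n + 1)) :
    fundWeight n i b = if b.val < i then 1 else 0 := by
  simp only [fundWeight, Finset.sum_apply, eps, Finset.sum_ite_eq, Finset.mem_Icc]
  congr 1
  simp

/-- A minimal representative is increasing on each of the blocks `{1, …, i}` and
`{i + 1, …, n + 1}`. -/
theorem IsMinRep.lt {n i : ℕ} {w : Perm (Fin (n + 1))} (hw : IsMinRep i w) {a b : Fin (n + 1)}
    (hab : a < b) (hblock : a.val < i ↔ b.val < i) : w a < w b := by
  by_contra! h
  have hlt := length_mul_swap_lt hab (h.lt_of_ne (w.injective.ne hab.ne'))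
  refine hlt.not_ge (hw _ (funext fun c => ?_))
  rw [act, symm_swap, fundWeight_apply, fundWeight_apply, swap_apply_def]
  split_ifs <;> grind

/-- A Bruhat step makes the values in the first block larger and those in the second block smaller,
as measured by counting the values beyond a threshold `q`. -/
theorem card_block_le_of_step {n i : ℕ} {u : Perm (Fin (n + 1))} {a b : Fin (n + 1)} (hab : a < b)
    (h : u a < u b) (q : Fin (n + 1)) :
    ({c | c.val < i ∧ q ≤ u c} : Finset (Fin (n + 1))).card ≤
        ({c | c.val < i ∧ q ≤ (u * swap a b) c} : Finset (Fin (n + 1))).card ∧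
      ({c | i ≤ c.val ∧ u c ≤ q} : Finset (Fin (n + 1))).card ≤
        ({c | i ≤ c.val ∧ (u * swap a b) c ≤ q} : Finset (Fin (n + 1))).card := by
  by_cases hblock : a.val < i ∧ i ≤ b.val
  · -- the swap moves a larger value into the first block and a smaller one into the second
    constructor <;> refine Finset.card_le_card fun c hc => ?_ <;>
      rw [Finset.mem_filter_univ] at hc ⊢ <;> rw [Perm.mul_apply, swap_apply_def] <;>
      split_ifs <;> grind
  · -- the swap permutes each block
    constructor <;>
      refine Finset.card_le_card_of_injOn (swap a b) (fun c hc => ?_) (swap a b).injective.injOn <;>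
      simp only [Finset.coe_filter, Set.mem_ofPred_eq, Finset.mem_univ, true_and, Perm.mul_apply]
        at hc ⊢ <;>
      rw [swap_apply_def] <;> split_ifs <;> grind

theorem BruhatLE.card_block_le {n i : ℕ} {τ w : Perm (Fin (n + 1))} (h : BruhatLE τ w)
    (q : Fin (n + 1)) :
    ({c | c.val < i ∧ q ≤ τ c} : Finset (Fin (n + 1))).card ≤
        ({c | c.val < i ∧ q ≤ w c} : Finset (Fin (n + 1))).card ∧
      ({c | i ≤ c.val ∧ τ c ≤ q} : Finset (Fin (n + 1))).card ≤
        ({c | i ≤ c.val ∧ w c ≤ q} : Finset (Fin (n + 1))).card := by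
  induction h with
  | refl => exact ⟨le_rfl, le_rfl⟩
  | @tail u _ _ hstep ih =>
    obtain ⟨⟨t, ⟨a, b, hab, rfl⟩, rfl⟩, hlt⟩ := hstep
    wlog hlt' : a < b generalizing a b
    · rw [swap_comm] at hlt ⊢
      exact this _ _ hab.symm hlt (hab.lt_or_gt.resolve_left hlt')
    have hval : u a < u b := by
      by_contra! hge
      exact (length_mul_swap_lt hlt' (hge.lt_of_ne (u.injective.ne hab.symm))).not_gt hlt
    have step := card_block_le_of_step (i := i) hlt' hval q
    exact ⟨ih.1.trans step.1, ih.2.trans step.2⟩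

theorem BruhatLE.apply_le_of_lt {n i : ℕ} {τ w : Perm (Fin (n + 1))} (h : BruhatLE τ w)
    (hτ : IsMinRep i τ) (hw : IsMinRep i w) {a : Fin (n + 1)} (ha : a.val < i) : τ a ≤ w a := by
  by_contra! hlt
  refine ((h.card_block_le (i := i) (τ a)).1.trans_lt (Finset.card_lt_card ?_)).false
  rw [Finset.ssubset_iff_of_subset]
  · exact ⟨a, by simp [ha], by simp [ha, hlt]⟩
  · intro c hc
    simp only [Finset.mem_filter, Finset.mem_univ, true_and] at hc ⊢
    rcases lt_trichotomy a c with hac | rfl | hac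
    · exact ⟨hc.1, (hτ.lt hac (by simp [ha, hc.1])).le⟩
    · exact ⟨ha, le_rfl⟩
    · exact absurd hc.2 ((hw.lt hac (by simp [ha, hc.1])).trans hlt).not_ge

theorem BruhatLE.apply_le_of_ge {n i : ℕ} {τ w : Perm (Fin (n + 1))} (h : BruhatLE τ w)
    (hτ : IsMinRep i τ) (hw : IsMinRep i w) {b : Fin (n + 1)} (hb : i ≤ b.val) : w b ≤ τ b := by
  by_contra! hlt
  refine ((h.card_block_le (i := i) (τ b)).2.trans_lt (Finset.card_lt_card ?_)).false
  rw [Finset.ssubset_iff_of_subset]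
  · exact ⟨b, by simp [hb], by simp [hb, hlt]⟩
  · intro c hc
    simp only [Finset.mem_filter, Finset.mem_univ, true_and] at hc ⊢
    rcases lt_trichotomy b c with hbc | rfl | hbc
    · exact absurd hc.2 (hlt.trans (hw.lt hbc (by omega))).not_ge
    · exact ⟨hb, le_rfl⟩
    · exact ⟨hc.1, (hτ.lt hbc (by omega)).le⟩

/-- An inversion of a minimal representative joins the two blocks. -/
theorem IsMinRep.block_of_inv {n i : ℕ} {w : Perm (Fin (n + 1))} (hw : IsMinRep i w)
    {a b : Fin (n + 1)} (hab : a < b) (h : w b < w a) : a.val < i ∧ i ≤ b.val := by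
  by_contra hc
  exact (hw.lt hab (by omega)).not_gt h

theorem BruhatLE.invRoots_subset {n i : ℕ} {τ w : Perm (Fin (n + 1))} (h : BruhatLE τ w)
    (hτ : IsMinRep i τ) (hw : IsMinRep i w) : invRoots τ ⊆ invRoots w := by
  intro α hα
  obtain ⟨a, b, hab, rfl⟩ := mem_posRoots_iff.1 hα.2
  rw [single_sub_single_mem_invRoots_iff hab] at hα ⊢
  obtain ⟨ha, hb⟩ := hτ.block_of_inv hab hα
  exact ((h.apply_le_of_ge hτ hw hb).trans_lt hα).trans_le (h.apply_le_of_lt hτ hw ha)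

/-! ### The abelian nilradical and its grading element -/

/-- The Lie subalgebra of the matrices supported in rows `> i` and columns `≤ i`. -/
def lowerBlock (n i : ℕ) : LieSubalgebra ℂ (sl n) where
  carrier := {x | ∀ a b : Fin (n + 1), ¬ (i ≤ a.val ∧ b.val < i) → x.val a b = 0}
  zero_mem' _ _ _ := rfl
  add_mem' {x y} hx hy a b h := by
    change x.val a b + y.val a b = 0
    rw [hx a b h, hy a b h, add_zero]
  smul_mem' c x hx a b h := by
    change c * x.val a b = 0
    rw [hx a b h, mul_zero]
  lie_mem' {x y} hx hy a b _ := by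
    -- the product of two such matrices is zero
    have key : ∀ x y : sl n,
        (∀ a b : Fin (n + 1), ¬ (i ≤ a.val ∧ b.val < i) → x.val a b = 0) →
        (∀ a b : Fin (n + 1), ¬ (i ≤ a.val ∧ b.val < i) → y.val a b = 0) →
        (x.val * y.val) a b = 0 := by
      intro x y hx hy
      rw [Matrix.mul_apply]
      refine Finset.sum_eq_zero fun c _ => ?_
      by_cases hc : c.val < i
      · rw [hy c b (by omega), mul_zero]
      · rw [hx a c (by omega), zero_mul]
    rw [LieAlgebra.SpecialLinear.sl_bracket, Matrix.sub_apply, key x y hx hy, key y x hy hx,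
      sub_zero]

theorem IsMinRep.nMinus_le_lowerBlock {n i : ℕ} {w : Perm (Fin (n + 1))} (hw : IsMinRep i w) :
    nMinus w ≤ lowerBlock n i := by
  refine LieSubalgebra.lieSpan_le.2 ?_
  rintro x ⟨k, j, hk, hkj, hj, hmem, hx⟩ a b hab
  rw [hx, matUnit, Matrix.of_apply, if_neg]
  rintro ⟨ha, rfl⟩
  obtain rfl : a.val = j := Nat.succ_injective ha
  have hlt : b < a := by omega
  rw [root_mem_invRoots_iff hlt] at hmem
  exact hab (hw.block_of_inv hlt hmem).symm

theorem nMinus_mono {n : ℕ} {τ w : Perm (Fin (n + 1))} (h : invRoots τ ⊆ invRoots w) :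
    nMinus τ ≤ nMinus w := by
  refine LieSubalgebra.lieSpan_mono ?_
  rintro x ⟨k, j, hk, hkj, hj, hmem, hx⟩
  exact ⟨k, j, hk, hkj, hj, h hmem, hx⟩

/-- The multiple by `n + 1` of the fundamental coweight `ω_i^∨`: the diagonal matrix with the
entries `n + 1 - i` (in the first `i` places) and `-i`. -/
def coweight (n i : ℕ) (hin : i ≤ n) : sl n :=
  ⟨Matrix.diagonal fun a : Fin (n + 1) => (if a.val < i then (n + 1 : ℂ) else 0) - i, by
    change _ ∈ LinearMap.ker (Matrix.traceLinearMap (Fin (n + 1)) ℂ ℂ)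
    rw [LinearMap.mem_ker, Matrix.traceLinearMap_apply, Matrix.trace_diagonal,
      Finset.sum_sub_distrib, ← Finset.sum_filter, Finset.sum_const,
      Finset.sum_const, Finset.card_univ, Fintype.card_fin, Fin.card_filter_val_lt,
      min_eq_right (by omega), nsmul_eq_mul, nsmul_eq_mul]
    push_cast
    ring⟩

theorem coweight_lie {n i : ℕ} (hin : i ≤ n) {x : sl n} (hx : x ∈ lowerBlock n i) :
    ⁅coweight n i hin, x⁆ = (-(n + 1 : ℂ)) • x := by
  refine Subtype.ext (Matrix.ext fun a b => ?_)
  rw [LieAlgebra.SpecialLinear.sl_bracket]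
  change _ = -(n + 1 : ℂ) * x.val a b
  rw [coweight, Matrix.sub_apply, Matrix.diagonal_mul, Matrix.mul_diagonal]
  by_cases h : i ≤ a.val ∧ b.val < i
  · rw [if_neg (by omega), if_pos h.2]
    ring
  · rw [hx a b h]
    ring

end TypeA

/-! ### Faces of chain polytopes -/

namespace ChainPoset

theorem zero_mem_chainPolytope (i : ℕ) (l : ℕ → ℕ) : 0 ∈ chainPolytope i l :=
  ⟨fun _ => le_rfl, fun c _ => by simp⟩

variable {i : ℕ} {l l' : ℕ → ℕ}

/-- The inclusion of the vertices of `P_ℓ` into those of `P_ℓ'`. -/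
def Vert.incl (h : ∀ k, 1 ≤ k → k ≤ i → l k ≤ l' k) (x : Vert i l) : Vert i l' :=
  ⟨x.1, x.2.1, x.2.2.1, x.2.2.2.trans (h _ x.2.1.1 x.2.1.2)⟩

theorem Vert.incl_injective (h : ∀ k, 1 ≤ k → k ≤ i → l k ≤ l' k) :
    Function.Injective (Vert.incl h) := fun _ _ e =>
  Subtype.ext (congrArg (fun z : Vert i l' => z.1) e)

theorem extendZero_apply_of_mem {s : Vert i l → ℝ} {x : Vert i l'} (hx : x.1.2 ≤ l x.1.1) :
    extendZero i l l' s x = s ⟨x.1, x.2.1, x.2.2.1, hx⟩ :=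
  dif_pos _

theorem extendZero_apply_of_not_mem {s : Vert i l → ℝ} {x : Vert i l'} (hx : ¬ x.1.2 ≤ l x.1.1) :
    extendZero i l l' s x = 0 :=
  dif_neg fun H => hx H.2.2

theorem extendZero_smul (m : ℝ) (s : Vert i l → ℝ) :
    extendZero i l l' (m • s) = m • extendZero i l l' s := by
  funext x
  by_cases hx : x.1.2 ≤ l x.1.1
  · rw [Pi.smul_apply, extendZero_apply_of_mem hx, extendZero_apply_of_mem hx]
    rfl
  · simp [extendZero_apply_of_not_mem hx]

theorem sum_extendZero_eq (h : ∀ k, 1 ≤ k → k ≤ i → l k ≤ l' k) (s : Vert i l → ℝ)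
    (c : Finset (Vert i l')) :
    ∑ x ∈ c, extendZero i l l' s x =
      ∑ x ∈ c.preimage (Vert.incl h) (Vert.incl_injective h).injOn,
        s x := by
  rw [← Finset.sum_preimage (Vert.incl h) c (Vert.incl_injective h).injOn]
  · exact Finset.sum_congr rfl fun x _ => extendZero_apply_of_mem x.2.2.2
  · intro x _ hx
    refine extendZero_apply_of_not_mem fun hle => hx ⟨⟨x.1, x.2.1, x.2.2.1, hle⟩, rfl⟩

theorem extendZero_mem_chainPolytope (h : ∀ k, 1 ≤ k → k ≤ i → l k ≤ l' k) {s : Vert i l → ℝ}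
    (hs : s ∈ chainPolytope i l) : extendZero i l l' s ∈ chainPolytope i l' := by
  refine ⟨fun x => ?_, fun c hc => ?_⟩
  · by_cases hx : x.1.2 ≤ l x.1.1
    · rw [extendZero_apply_of_mem hx]; exact hs.1 _
    · rw [extendZero_apply_of_not_mem hx]
  · rw [sum_extendZero_eq h]
    refine hs.2 _ fun x hx y hy hxy => ?_
    exact hc (Finset.mem_preimage.1 hx) (Finset.mem_preimage.1 hy)
      fun e => hxy (Vert.incl_injective h e)

theorem comp_incl_mem_chainPolytope (h : ∀ k, 1 ≤ k → k ≤ i → l k ≤ l' k) {s : Vert i l' → ℝ}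
    (hs : s ∈ chainPolytope i l') : s ∘ Vert.incl h ∈ chainPolytope i l := by
  classical
  refine ⟨fun x => hs.1 _, fun c hc => ?_⟩
  have := hs.2 (c.image (Vert.incl h)) ?_
  · rwa [Finset.sum_image (Vert.incl_injective h).injOn] at this
  · rw [Finset.coe_image]
    rintro _ ⟨x, hx, rfl⟩ _ ⟨y, hy, rfl⟩ hxy
    exact hc hx hy fun e => hxy (congrArg _ e)

/-- For `ℓ ≤ ℓ'`, the dilated chain polytope of `P_ℓ` is the face of that of `P_ℓ'` on which the
coordinates outside `P_ℓ` vanish. -/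
theorem extendZero_image_smul_chainPolytope (h : ∀ k, 1 ≤ k → k ≤ i → l k ≤ l' k) (m : ℝ) :
    extendZero i l l' '' (m • chainPolytope i l) =
      {s ∈ m • chainPolytope i l' | ∀ x : Vert i l', ¬ x.1.2 ≤ l x.1.1 → s x = 0} := by
  ext s
  constructor
  · rintro ⟨_, ⟨t, ht, rfl⟩, rfl⟩
    refine ⟨⟨_, extendZero_mem_chainPolytope h ht, (extendZero_smul m t).symm⟩, fun x hx => ?_⟩
    exact extendZero_apply_of_not_mem hx
  · rintro ⟨⟨t, ht, rfl⟩, h0⟩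
    refine ⟨_, ⟨_, comp_incl_mem_chainPolytope h ht, rfl⟩, funext fun x => ?_⟩
    by_cases hx : x.1.2 ≤ l x.1.1
    · exact extendZero_apply_of_mem hx
    · exact (extendZero_apply_of_not_mem hx).trans (h0 x hx).symm

instance : Finite (Vert i l) := by
  refine Set.Finite.to_subtype (s := {x : ℕ × ℕ | (1 ≤ x.1 ∧ x.1 ≤ i) ∧ i ≤ x.2 ∧ x.2 ≤ l x.1}) ?_
  refine ((Set.finite_Icc 1 i).biUnion fun k _ =>
    (Set.finite_Icc i (l k)).image (Prod.mk k)).subset ?_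
  rintro ⟨k, j⟩ ⟨hk, hj⟩
  exact Set.mem_biUnion hk ⟨j, hj, rfl⟩

/-- The vanishing of a set of coordinates cuts out an exposed face of the dilated polytope: the
sum of these coordinates is nonnegative on it, and `0` at the origin. -/
theorem isExposed_smul_chainPolytope {m : ℝ} (hm : 0 ≤ m) (p : Vert i l → Prop) :
    IsExposed ℝ (m • chainPolytope i l)
      {s ∈ m • chainPolytope i l | ∀ x, p x → s x = 0} := by
  classical
  intro _
  have := Fintype.ofFinite (Vert i l)
  have hnn : ∀ s ∈ m • chainPolytope i l, ∀ x, 0 ≤ s x := by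
    rintro _ ⟨t, ht, rfl⟩ x
    exact mul_nonneg hm (ht.1 x)
  have h0 : (0 : Vert i l → ℝ) ∈ m • chainPolytope i l :=
    ⟨0, zero_mem_chainPolytope i l, smul_zero m⟩
  refine ⟨-∑ x with p x, ContinuousLinearMap.proj x, ?_⟩
  have hval : ∀ s : Vert i l → ℝ,
      (-∑ x with p x, ContinuousLinearMap.proj x : StrongDual ℝ (Vert i l → ℝ)) s =
        -∑ x with p x, s x := fun s => by
    simp
  ext s
  refine and_congr_right fun hs => ⟨fun h y hy => ?_, fun h => ?_⟩
  · rw [hval, hval, Finset.sum_eq_zero fun x hx => h x (Finset.mem_filter.1 hx).2]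
    exact neg_le_neg (Finset.sum_nonneg fun x _ => hnn y hy x)
  · have hle := h 0 h0
    rw [hval, hval] at hle
    have hsum : ∑ x with p x, s x = 0 :=
      le_antisymm (by simpa using hle) (Finset.sum_nonneg fun x _ => hnn s hs x)
    intro x hx
    exact (Finset.sum_eq_zero_iff_of_nonneg fun x _ => hnn s hs x).1 hsum x (by simpa using hx)

end ChainPoset

/-! ### The sequence of a minimal representative -/

namespace TypeA

open Equiv

theorem bddAbove_ellSeq {n : ℕ} (i : ℕ) (w : Perm (Fin (n + 1))) (k : ℕ) :
    BddAbove ({i - 1} ∪ {j | i ≤ j ∧ j ≤ n ∧ root n k j ∈ invRoots w}) :=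
  (Set.finite_singleton (i - 1)).bddAbove.union ⟨n, fun _ hj => hj.2.1⟩

/-- As `w` is increasing on the second block, the `j` with `α_{k,j} ∈ R⁻_w` form an interval
starting at `i`, so that `P_{ℓ_w}` consists of the `x_{k,j}` with `α_{k,j} ∈ R⁻_w`. -/
theorem IsMinRep.le_ellSeq_iff {n i : ℕ} {w : Perm (Fin (n + 1))} (hw : IsMinRep i w)
    {k j : ℕ} (hk : 1 ≤ k) (hki : k ≤ i) (hij : i ≤ j) :
    j ≤ ellSeq i w k ↔ j ≤ n ∧ root n k j ∈ invRoots w := by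
  refine ⟨fun h => ?_, fun h => le_csSup (bddAbove_ellSeq i w k) (Or.inr ⟨hij, h.1, h.2⟩)⟩
  rcases Nat.sSup_mem ⟨i - 1, Or.inl rfl⟩ (bddAbove_ellSeq i w k) with he | ⟨-, hn, hmem⟩
  · have : ellSeq i w k = i - 1 := he
    omega
  · change ellSeq i w k ≤ n at hn
    change root n k (ellSeq i w k) ∈ invRoots w at hmem
    refine ⟨h.trans hn, ?_⟩
    obtain ⟨k, rfl⟩ := Nat.exists_eq_add_of_le' hk
    have key : ∀ b : Fin (n + 1), i ≤ b.val →
        (root n (k + 1) b ∈ invRoots w ↔ w b < w ⟨k, by omega⟩) := fun b hb =>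
      root_mem_invRoots_iff (a := ⟨k, by omega⟩) (Fin.mk_lt_of_lt_val (by omega))
    rw [key ⟨j, by omega⟩ hij]
    have hlast := (key ⟨_, Nat.lt_succ_of_le hn⟩ (hij.trans h)).1 hmem
    rcases h.eq_or_lt with he | hlt
    · simpa only [he] using hlast
    · exact (hw.lt (Fin.mk_lt_mk.2 hlt) (by simp only; omega)).trans hlast

theorem ellSeq_mono {n : ℕ} {τ w : Perm (Fin (n + 1))} (h : invRoots τ ⊆ invRoots w) (i k : ℕ) :
    ellSeq i τ k ≤ ellSeq i w k :=
  csSup_le_csSup (bddAbove_ellSeq i w k) ⟨i - 1, Or.inl rfl⟩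
    (Set.union_subset_union_right _ fun _ hj => ⟨hj.1, hj.2.1, h hj.2.2⟩)

end TypeA

open ChainPoset TypeA PBW in
theorem corollary3p3 (n i m : ℕ) (hi : 1 ≤ i) (hin : i ≤ n)
    (w τ : Equiv.Perm (Fin (n + 1))) (hw : IsMinRep i w) (hτ : IsMinRep i τ)
    (hle : BruhatLE τ w) :
    (invRoots τ ⊆ invRoots w ∧
      extendZero i (ellSeq i τ) (ellSeq i w) '' ((m : ℝ) • chainPolytope i (ellSeq i τ)) =
        {s ∈ (m : ℝ) • chainPolytope i (ellSeq i w) |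
          ∀ x : Vert i (ellSeq i w),
            root n x.1.1 x.1.2 ∈ invRoots w \ invRoots τ → s x = 0} ∧
      IsExposed ℝ ((m : ℝ) • chainPolytope i (ellSeq i w))
        (extendZero i (ellSeq i τ) (ellSeq i w) '' ((m : ℝ) • chainPolytope i (ellSeq i τ)))) ∧
    (∀ (V : Type*) [AddCommGroup V] [Module ℂ V] [LieRingModule (sl n) V]
      [LieModule ℂ (sl n) V] [FiniteDimensional ℂ V] [LieModule.IsIrreducible ℂ (sl n) V]
      (v : V), IsHighestWeightVector n i m v →
      ∃ h : nMinus τ ≤ nMinus w,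
        Function.Injective (grMap h v) ∧
        ∀ (p : SymmetricAlgebra ℂ (nMinus τ)) (y : Gr (nMinus τ) v),
          grMap h v (symAct (nMinus τ) v p y) =
            symAct (nMinus w) v (symMap h p) (grMap h v y)) := by
  have hsub := hle.invRoots_subset hτ hw
  have hface : extendZero i (ellSeq i τ) (ellSeq i w) '' ((m : ℝ) • chainPolytope i (ellSeq i τ)) =
      {s ∈ (m : ℝ) • chainPolytope i (ellSeq i w) |
        ∀ x : Vert i (ellSeq i w),
          root n x.1.1 x.1.2 ∈ invRoots w \ invRoots τ → s x = 0} := by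
    rw [extendZero_image_smul_chainPolytope fun k _ _ => ellSeq_mono hsub i k]
    ext s
    refine and_congr_right fun _ => forall_congr' fun x => ?_
    obtain ⟨⟨hk, hki⟩, hij, hj⟩ := x.2
    have hmem := (hw.le_ellSeq_iff hk hki hij).1 hj
    rw [hτ.le_ellSeq_iff hk hki hij, Set.mem_sdiff]
    simp [hmem]
  refine ⟨⟨hsub, hface, ?_⟩, fun V _ _ _ _ _ _ v hv => ?_⟩
  · rw [hface]
    exact isExposed_smul_chainPolytope m.cast_nonneg _
  · have h := nMinus_mono hsub
    refine ⟨h, grMap_injective h v ?_, grMap_symAct h v⟩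
    exact fil_inf_filPred_le h (neg_ne_zero.2 (Nat.cast_add_one_ne_zero n))
      (fun x hx => coweight_lie hin (hw.nMinus_le_lowerBlock hx))
      (hv.weight (coweight n i hin) (Matrix.isDiag_diagonal _))
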